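/- For a finite non-empty graph $G$ with $n$ vertices, let $Z_G(\lambda)=\sum_{I}\lambda^{|I|}$, where the sum is over all independent sets $I$ of $G$ (including the empty set), let $F_G(\lambda)=\frac1n\log Z_G(\lambda)$, and let $E_G(\lambda)=\lambda\,\frac{\partial}{\partial\lambda}F_G(\lambda)$ be the occupancy fraction of the hard-core model on $G$ at fugacity $\lambda$. Let $W:[0,\infty)\to[0,\infty)$ be the positive real branch of the Lambert $W$-function, i.e. the inverse of $x\mapsto xe^x$ on $[0,\infty)$, and interpret $W(x)/x$ at $x=0$ as its limit $1$. There is an absolute constant $c>0$ such that the following holds. Let $G$ be a finite non-empty triangle-free graph with $n$ vertices, let $d_u$ be the degree of the vertex $u$, and let $\Delta=\max_{u\in V(G)}d_u$. Then for every $\lambda>0$ with $\lambda\le c/\Delta^4$ (no upper bound on $\lambda$ if $\Delta=0$), $$\frac1n\sum_{u\in V(G)}\frac{\lambda}{1+\lambda}\cdot\frac{W(d_u\log(1+\lambda))}{d_u\log(1+\lambda)}\le E_G(\lambda).$$ -/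

import Mathlib

noncomputable section

namespace HardCore

variable {V : Type*} [Fintype V]

open Classical in
/-- The partition function `Z_G(x) = ∑ x ^ |I|` of the hard-core model on a finite graph `G`,
the sum being over all independent sets `I` of `G`, the empty set included. -/
def partitionFunction (G : SimpleGraph V) (x : ℝ) : ℝ :=
  ∑ I ∈ (Finset.univ : Finset (Finset V)).filter (fun I : Finset V => G.IsIndepSet (I : Set V)), x ^ I.card

/-- The free energy density `F_G(x) = (1 / n) log Z_G(x)`, where `n` is the number of vertices. -/
def freeEnergyDensity (G : SimpleGraph V) (x : ℝ) : ℝ :=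
  1 / (Fintype.card V : ℝ) * Real.log (partitionFunction G x)

/-- The occupancy fraction `E_G(x) = x * F_G'(x)`. For `0 < x` the derivative exists, see
`differentiableAt_freeEnergyDensity`. -/
def occupancyFraction (G : SimpleGraph V) (x : ℝ) : ℝ :=
  x * deriv (freeEnergyDensity G) x

theorem partitionFunction_pos (G : SimpleGraph V) {x : ℝ} (hx : 0 < x) :
    0 < partitionFunction G x := by
  classical
  unfold partitionFunction
  refine Finset.sum_pos (fun I _ => pow_pos hx _) ⟨∅, ?_⟩
  simp [SimpleGraph.IsIndepSet]

theorem differentiableAt_freeEnergyDensity (G : SimpleGraph V) {x : ℝ} (hx : 0 < x) :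
    DifferentiableAt ℝ (freeEnergyDensity G) x := by
  have h : DifferentiableAt ℝ (partitionFunction G) x := by
    unfold partitionFunction
    fun_prop
  exact (h.log (partitionFunction_pos G hx).ne').const_mul _

end HardCore

/-- The positive real branch of the Lambert `W`-function: the inverse of `w ↦ w * exp w` on
`[0, ∞)`. Only its values on `[0, ∞)` are meaningful, see `lambertW_spec`, `lambertW_mul_exp`. -/
def lambertW (x : ℝ) : ℝ :=
  Function.invFunOn (fun w : ℝ => w * Real.exp w) (Set.Ici 0) x

/-- For `0 ≤ x`, the number `lambertW x` is nonnegative and solves `w * exp w = x`. -/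
theorem lambertW_spec {x : ℝ} (hx : 0 ≤ x) :
    0 ≤ lambertW x ∧ lambertW x * Real.exp (lambertW x) = x := by
  have hc : ContinuousOn (fun w : ℝ => w * Real.exp w) (Set.Icc 0 x) := by fun_prop
  have hmem : x ∈ Set.Icc ((fun w : ℝ => w * Real.exp w) 0) ((fun w : ℝ => w * Real.exp w) x) := by
    refine ⟨by simpa using hx, ?_⟩
    exact le_mul_of_one_le_right hx (Real.one_le_exp hx)
  obtain ⟨w, hw, hwx⟩ := intermediate_value_Icc hx hc hmem
  have hex : ∃ a ∈ Set.Ici (0 : ℝ), (fun w : ℝ => w * Real.exp w) a = x := ⟨w, hw.1, hwx⟩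
  exact ⟨Function.invFunOn_mem hex, Function.invFunOn_eq hex⟩

/-- For `0 ≤ w`, the number `w` is recovered from `w * exp w`. -/
theorem lambertW_mul_exp {w : ℝ} (hw : 0 ≤ w) : lambertW (w * Real.exp w) = w := by
  have hinj : Set.InjOn (fun w : ℝ => w * Real.exp w) (Set.Ici 0) := by
    refine StrictMonoOn.injOn fun a ha b _ hab => ?_
    exact mul_lt_mul'' hab (Real.exp_lt_exp.2 hab) ha (Real.exp_pos a).le
  have h := lambertW_spec (mul_nonneg hw (Real.exp_pos w).le)
  exact hinj h.1 hw h.2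

/-- The quotient `W(x) / x`, with its limit value `1` at `x = 0`. -/
def lambertWDiv (x : ℝ) : ℝ :=
  if x = 0 then 1 else lambertW x / x

end

/-!
Let `p v` be the probability that no neighbour of `v` is occupied, so that `v` is occupied with
probability `x / (1 + x) * p v`, and put `L = log (1 + x)`. It is enough to show
`∑ v, q v ≤ ∑ v, p v`, where `q v = exp (-w v)` and `w v = W (d v * L)`.

In a triangle-free graph the neighbourhood of `v` is independent, so the occupied vertices outside
it determine which neighbours are free to be occupied, and these are then occupied independently.
Hence `p v = 𝔼 (exp (-L * F))`, where `F` is the number of uncovered neighbours of `v`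
(`uncoveredProb_eq`). As `𝔼 F` is the sum of `p` over the neighbours of `v`, the tangent line of
`exp` at `-w v` gives `q v * (1 + w v - L * ∑ u ~ v, p u) ≤ p v` (`uncoveredProb_ge_tangent`).
Divide by `1 + w v`, write `a v = q v / (1 + w v)`, use `w v = d v * L * q v`, and sum over `v`:
`∑ v, q v + L * ∑ uv ∈ E, (a v - a u) * (p v - p u) ≤ ∑ v, p v`.

The edge sum is nonnegative, term by term. If `d u = d v`, then `a u = a v`. If `d u < d v`, then
`a v ≤ a u`, since `W` is monotone; and `p v ≤ p u`, since `p` agrees with `1 - L * d` up to an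
error of order `L ^ 2 * Δ ^ 2`, which is less than the gap `L` between different values of `L * d`
as long as `L * Δ ^ 2` is small (`uncoveredProb_le_of_degree_lt`).
-/

/-! ### Expectations in the hard-core model -/

namespace HardCore

variable {V : Type*} [Fintype V]

open Classical in
/-- The independent sets of `G`, as finite sets of vertices; the partition function sums over
exactly these. -/
noncomputable def indepSets (G : SimpleGraph V) : Finset (Finset V) :=
  Finset.univ.filter fun I : Finset V => G.IsIndepSet (I : Set V)

/-- The expectation of `f I` when `I` is drawn from the hard-core model on `G` at fugacity `x`. -/
noncomputable def average (G : SimpleGraph V) (x : ℝ) (f : Finset V → ℝ) : ℝ :=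
  (∑ I ∈ indepSets G, x ^ I.card * f I) / partitionFunction G x

/-- A vertex `v` is uncovered by `I` if no neighbour of `v` lies in `I`. The vertex `v` itself may
lie in `I`. -/
def Uncovered (G : SimpleGraph V) (I : Finset V) (v : V) : Prop :=
  ∀ w ∈ I, ¬ G.Adj v w

open Classical in
/-- The probability that `v` is uncovered by a random independent set. -/
noncomputable def uncoveredProb (G : SimpleGraph V) (x : ℝ) (v : V) : ℝ :=
  average G x fun I => if Uncovered G I v then 1 else 0

open Classical in
/-- The neighbours of `v` that are uncovered by `I`. -/
noncomputable def uncoveredNeighbors (G : SimpleGraph V) (I : Finset V) (v : V) : Finset V :=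
  Finset.univ.filter fun w => G.Adj v w ∧ Uncovered G I w

theorem mem_indepSets {G : SimpleGraph V} {I : Finset V} :
    I ∈ indepSets G ↔ ∀ u ∈ I, ∀ v ∈ I, ¬ G.Adj u v := by
  classical
  simp only [indepSets, Finset.mem_filter, Finset.mem_univ, true_and, SimpleGraph.IsIndepSet,
    Set.Pairwise, Finset.mem_coe]
  refine ⟨fun h u hu v hv huv => h hu hv huv.ne huv, fun h u hu v hv _ => h u hu v hv⟩

theorem mem_uncoveredNeighbors {G : SimpleGraph V} {I : Finset V} {v w : V} :
    w ∈ uncoveredNeighbors G I v ↔ G.Adj v w ∧ ∀ u ∈ I, ¬ G.Adj w u := by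
  classical
  unfold uncoveredNeighbors
  simp only [Finset.mem_filter, Finset.mem_univ, true_and]
  rfl

theorem partitionFunction_eq (G : SimpleGraph V) (x : ℝ) :
    partitionFunction G x = ∑ I ∈ indepSets G, x ^ I.card := rfl

theorem average_mono (G : SimpleGraph V) {x : ℝ} (hx : 0 < x) {f g : Finset V → ℝ}
    (h : ∀ I, f I ≤ g I) : average G x f ≤ average G x g := by
  unfold average
  have := partitionFunction_pos G hx
  gcongr
  exact h _

theorem average_affine (G : SimpleGraph V) {x : ℝ} (hx : 0 < x) (a b : ℝ) (f : Finset V → ℝ) :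
    average G x (fun I => a + b * f I) = a + b * average G x f := by
  have := (partitionFunction_pos G hx).ne'
  unfold average
  field_simp
  rw [partitionFunction_eq, Finset.mul_sum, Finset.mul_sum, ← Finset.sum_add_distrib]
  exact Finset.sum_congr rfl fun I _ => by ring

theorem average_sum (G : SimpleGraph V) (x : ℝ) {ι : Type*} (s : Finset ι)
    (f : ι → Finset V → ℝ) :
    average G x (fun I => ∑ i ∈ s, f i I) = ∑ i ∈ s, average G x (f i) := by
  unfold average
  simp_rw [Finset.mul_sum]
  rw [Finset.sum_comm, Finset.sum_div]

theorem uncoveredProb_le_one (G : SimpleGraph V) {x : ℝ} (hx : 0 < x) (v : V) :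
    uncoveredProb G x v ≤ 1 := by
  classical
  have h := average_mono G hx (g := fun _ => 1 + 0 * 0)
    (f := fun I => if Uncovered G I v then 1 else 0) fun I => by split_ifs <;> simp
  rw [average_affine G hx 1 0 fun _ => 0] at h
  simpa [uncoveredProb] using h

theorem average_card_uncoveredNeighbors (G : SimpleGraph V) [DecidableRel G.Adj] (x : ℝ) (v : V) :
    average G x (fun I => ((uncoveredNeighbors G I v).card : ℝ)) =
      ∑ w ∈ G.neighborFinset v, uncoveredProb G x w := by
  classical
  unfold uncoveredProb
  rw [← average_sum]
  congr 1
  funext I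
  rw [Finset.sum_boole]
  congr 2
  ext w
  simp [uncoveredNeighbors]

/-! ### Occupation probabilities and the occupancy fraction -/

open Classical in
/-- A vertex is occupied with probability `x / (1 + x)` times the probability that it is uncovered:
given that `v` is uncovered, adding or deleting `v` keeps the set independent and changes its weight
by the factor `x`. -/
theorem average_mem (G : SimpleGraph V) {x : ℝ} (hx : 0 < x) (v : V) :
    average G x (fun I => if v ∈ I then 1 else 0) = x / (1 + x) * uncoveredProb G x v := by
  have key : ∑ I ∈ indepSets G with v ∈ I, x ^ I.card =
      x * ∑ I ∈ indepSets G with v ∉ I ∧ Uncovered G I v, x ^ I.card := by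
    rw [Finset.mul_sum]
    refine Finset.sum_nbij' (fun I => I.erase v) (fun I => insert v I) ?_ ?_ ?_ ?_ ?_
    · intro I hI
      simp only [Finset.mem_filter, mem_indepSets] at hI ⊢
      simp only [Uncovered, Finset.mem_erase]
      exact ⟨fun u hu w hw => hI.1 u hu.2 w hw.2, by simp, fun w hw => hI.1 v hI.2 w hw.2⟩
    · intro I hI
      simp only [Finset.mem_filter, mem_indepSets, Finset.mem_insert] at hI ⊢
      refine ⟨?_, by simp⟩
      rintro u (rfl | hu) w (rfl | hw)
      · simp
      · exact hI.2.2 w hw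
      · exact fun h => hI.2.2 u hu h.symm
      · exact hI.1 u hu w hw
    · intro I hI
      exact Finset.insert_erase (Finset.mem_filter.1 hI).2
    · intro I hI
      exact Finset.erase_insert (Finset.mem_filter.1 hI).2.1
    · intro I hI
      rw [← pow_succ', Finset.card_erase_add_one (Finset.mem_filter.1 hI).2]
  have split : ∑ I ∈ indepSets G with Uncovered G I v, x ^ I.card =
      ∑ I ∈ indepSets G with v ∈ I, x ^ I.card +
        ∑ I ∈ indepSets G with v ∉ I ∧ Uncovered G I v, x ^ I.card := by
    rw [← Finset.sum_filter_add_sum_filter_not _ (fun I => v ∈ I), Finset.filter_filter,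
      Finset.filter_filter]
    congr 1
    · refine Finset.sum_congr (Finset.filter_congr fun I hI => ?_) fun _ _ => rfl
      exact ⟨fun h => h.2, fun h => ⟨fun w hw => mem_indepSets.1 hI v h w hw, h⟩⟩
    · refine Finset.sum_congr (Finset.filter_congr fun I hI => ?_) fun _ _ => rfl
      exact and_comm
  unfold uncoveredProb average
  simp_rw [mul_ite, mul_one, mul_zero, ← Finset.sum_filter]
  rw [split, key]
  field_simp
  ring

/-- The occupancy fraction is the average over the vertices of the occupation probabilities. -/
theorem occupancyFraction_eq (G : SimpleGraph V) {x : ℝ} (hx : 0 < x) :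
    occupancyFraction G x =
      1 / (Fintype.card V : ℝ) * ∑ v, x / (1 + x) * uncoveredProb G x v := by
  classical
  have hZ := partitionFunction_pos G hx
  have hd : HasDerivAt (partitionFunction G)
      (∑ I ∈ indepSets G, (I.card : ℝ) * x ^ (I.card - 1)) x :=
    HasDerivAt.fun_sum fun I _ => hasDerivAt_pow I.card x
  have hF : deriv (freeEnergyDensity G) x = _ :=
    ((hd.log hZ.ne').const_mul (1 / (Fintype.card V : ℝ))).deriv
  have hcard : ∑ v, x / (1 + x) * uncoveredProb G x v =
      average G x fun I => (I.card : ℝ) := by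
    simp_rw [← average_mem G hx]
    rw [← average_sum]
    congr 1
    funext I
    simp
  rw [occupancyFraction, hF, hcard, average, mul_left_comm, ← mul_div_assoc, Finset.mul_sum]
  congr 2
  refine Finset.sum_congr rfl fun I _ => ?_
  rcases Nat.eq_zero_or_pos I.card with h | h
  · simp [h]
  · rw [mul_left_comm, mul_pow_sub_one h.ne', mul_comm]

/-! ### Uncovered probabilities in triangle-free graphs -/

/-- In a triangle-free graph, whether a neighbour of `v` is uncovered does not depend on the
occupied neighbours of `v`. -/
theorem uncoveredNeighbors_congr {G : SimpleGraph V} (hG : G.CliqueFree 3) {I J : Finset V} {v : V}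
    (h : ∀ w, ¬ G.Adj v w → (w ∈ I ↔ w ∈ J)) :
    uncoveredNeighbors G I v = uncoveredNeighbors G J v := by
  classical
  ext w
  rw [mem_uncoveredNeighbors, mem_uncoveredNeighbors]
  refine and_congr_right fun hw => forall_congr' fun u => ?_
  by_cases hu : G.Adj v u
  · have : ¬ G.Adj w u := fun hwu =>
      hG {v, w, u} (SimpleGraph.is3Clique_triple_iff.2 ⟨hw, hu, hwu⟩)
    simp [this]
  · rw [h u hu]

open Classical in
/-- Spatial Markov property at the neighbourhood of `v`. Given the occupied vertices outside the
neighbourhood, the occupied neighbours of `v` form an arbitrary subset of the uncovered ones, so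
that none of them is occupied with conditional probability `(1 + x) ^ (-F)`, where `F` is the number
of uncovered neighbours. -/
theorem uncoveredProb_eq {G : SimpleGraph V} (hG : G.CliqueFree 3) {x : ℝ} (hx : 0 < x) (v : V) :
    uncoveredProb G x v =
      average G x fun I => Real.exp (-(Real.log (1 + x) * (uncoveredNeighbors G I v).card)) := by
  have hexp (n : ℕ) : Real.exp (-(Real.log (1 + x) * n)) = ((1 + x) ^ n)⁻¹ := by
    rw [Real.exp_neg, mul_comm, Real.exp_nat_mul, Real.exp_log (by linarith)]
  have htri {u w : V} (hu : G.Adj v u) (hw : G.Adj v w) : ¬ G.Adj u w := fun huw =>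
    hG {v, u, w} (SimpleGraph.is3Clique_triple_iff.2 ⟨hu, hw, huw⟩)
  unfold uncoveredProb average
  simp_rw [hexp, mul_ite, mul_one, mul_zero, ← Finset.sum_filter]
  congr 1
  symm
  set N : Finset V := Finset.univ.filter fun w => G.Adj v w with hN
  have hmem {w : V} : w ∈ N ↔ G.Adj v w := by simp [hN]
  rw [← Finset.sum_fiberwise_of_maps_to (g := fun I => I \ N)
    (t := (indepSets G).filter fun J => Uncovered G J v)]
  · refine Finset.sum_congr rfl fun J hJ => ?_
    rw [Finset.mem_filter, mem_indepSets] at hJ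
    have hJN : Disjoint J N := Finset.disjoint_left.2 fun w hw hwN => hJ.2 w hw (hmem.1 hwN)
    have hfree : uncoveredNeighbors G J v ⊆ N := fun w hw =>
      hmem.2 (mem_uncoveredNeighbors.1 hw).1
    have hfiber : ∑ I ∈ indepSets G with I \ N = J,
          x ^ I.card * ((1 + x) ^ (uncoveredNeighbors G I v).card)⁻¹ =
        ∑ S ∈ (uncoveredNeighbors G J v).powerset, x ^ J.card *
          ((1 + x) ^ (uncoveredNeighbors G J v).card)⁻¹ * x ^ S.card := by
      refine Finset.sum_nbij' (fun I => I ∩ N) (fun S => J ∪ S) ?_ ?_ ?_ ?_ ?_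
      · intro I hI
        rw [Finset.mem_filter, mem_indepSets] at hI
        rw [Finset.mem_powerset]
        intro w hw
        rw [Finset.mem_inter] at hw
        refine mem_uncoveredNeighbors.2 ⟨hmem.1 hw.2, fun u hu => hI.1 w hw.1 u ?_⟩
        rw [← hI.2] at hu
        exact (Finset.mem_sdiff.1 hu).1
      · intro S hS
        rw [Finset.mem_powerset] at hS
        rw [Finset.mem_filter, mem_indepSets]
        have hS' {w : V} (hw : w ∈ S) : G.Adj v w ∧ Uncovered G J w :=
          mem_uncoveredNeighbors.1 (hS hw)
        constructor
        · simp only [Finset.mem_union]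
          rintro u (hu | hu) w (hw | hw)
          · exact hJ.1 u hu w hw
          · exact fun h => (hS' hw).2 u hu h.symm
          · exact (hS' hu).2 w hw
          · exact htri (hS' hu).1 (hS' hw).1
        · rw [Finset.union_sdiff_distrib, Finset.sdiff_eq_self_of_disjoint hJN,
            Finset.sdiff_eq_empty_iff_subset.2 (hS.trans hfree), Finset.union_empty]
      · intro I hI
        rw [← (Finset.mem_filter.1 hI).2, Finset.sdiff_union_inter]
      · intro S hS
        rw [Finset.mem_powerset] at hS
        rw [Finset.union_inter_distrib_right, Finset.disjoint_iff_inter_eq_empty.1 hJN,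
          Finset.inter_eq_left.2 (hS.trans hfree), Finset.empty_union]
      · intro I hI
        have hIJ := (Finset.mem_filter.1 hI).2
        rw [uncoveredNeighbors_congr hG (J := J) fun w hw => ?_]
        · rw [← Finset.card_sdiff_add_card_inter I N, hIJ, pow_add]
          ring
        · rw [← hIJ, Finset.mem_sdiff, hmem]
          simp [hw]
    have hbinom := Finset.sum_pow_mul_eq_add_pow x 1 (uncoveredNeighbors G J v)
    simp only [one_pow, mul_one] at hbinom
    rw [hfiber, ← Finset.mul_sum, hbinom, add_comm x 1, mul_assoc, inv_mul_cancel₀, mul_one]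
    positivity
  · intro I hI
    rw [Finset.mem_filter, mem_indepSets]
    rw [mem_indepSets] at hI
    refine ⟨fun u hu w hw => hI u (Finset.mem_sdiff.1 hu).1 w (Finset.mem_sdiff.1 hw).1, ?_⟩
    exact fun w hw h => (Finset.mem_sdiff.1 hw).2 (hmem.2 h)

/-- The tangent line of `exp` at `-t` bounds the uncovered probability of a vertex from below by an
affine function of those of its neighbours. -/
theorem uncoveredProb_ge_tangent {G : SimpleGraph V} [DecidableRel G.Adj] (hG : G.CliqueFree 3)
    {x : ℝ} (hx : 0 < x) (v : V) (t : ℝ) :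
    Real.exp (-t) * (1 + t - Real.log (1 + x) * ∑ u ∈ G.neighborFinset v, uncoveredProb G x u) ≤
      uncoveredProb G x v := by
  rw [uncoveredProb_eq hG hx v, ← average_card_uncoveredNeighbors]
  calc _ = Real.exp (-t) * (1 + t) + -(Real.exp (-t) * Real.log (1 + x)) *
        average G x (fun I => ((uncoveredNeighbors G I v).card : ℝ)) := by ring
    _ ≤ _ := by
      rw [← average_affine G hx]
      refine average_mono G hx fun I => ?_
      set y := Real.log (1 + x) * ((uncoveredNeighbors G I v).card : ℝ) with hy
      calc _ = Real.exp (-t) * (t - y + 1) := by rw [hy]; ring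
        _ ≤ Real.exp (-t) * Real.exp (t - y) := by
          gcongr
          exact Real.add_one_le_exp _
        _ = Real.exp (-y) := by rw [← Real.exp_add]; ring_nf

theorem one_sub_le_uncoveredProb {G : SimpleGraph V} [DecidableRel G.Adj] (hG : G.CliqueFree 3)
    {x : ℝ} (hx : 0 < x) (v : V) :
    1 - Real.log (1 + x) * G.degree v ≤ uncoveredProb G x v := by
  have hL : 0 ≤ Real.log (1 + x) := Real.log_nonneg (by linarith)
  have h := uncoveredProb_ge_tangent hG hx v 0
  have hs : ∑ u ∈ G.neighborFinset v, uncoveredProb G x u ≤ G.degree v := by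
    refine (Finset.sum_le_sum fun u _ => uncoveredProb_le_one G hx u).trans ?_
    simp
  have := mul_le_mul_of_nonneg_left hs hL
  simp only [neg_zero, Real.exp_zero] at h
  linarith

theorem uncoveredProb_le {G : SimpleGraph V} [DecidableRel G.Adj] (hG : G.CliqueFree 3)
    {x : ℝ} (hx : 0 < x) (v : V) :
    uncoveredProb G x v ≤ 1 - Real.log (1 + x) * G.degree v +
      3 / 2 * (Real.log (1 + x) * G.maxDegree) ^ 2 := by
  classical
  set L := Real.log (1 + x) with hLdef
  have hL : 0 ≤ L := Real.log_nonneg (by linarith)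
  have hdeg (u : V) : (G.degree u : ℝ) ≤ G.maxDegree := by exact_mod_cast G.degree_le_maxDegree u
  have hs : (G.degree v : ℝ) * (1 - L * G.maxDegree) ≤
      ∑ u ∈ G.neighborFinset v, uncoveredProb G x u := by
    rw [← G.card_neighborFinset_eq_degree v, ← nsmul_eq_mul]
    refine Finset.card_nsmul_le_sum _ _ _ fun u _ => ?_
    refine le_trans ?_ (one_sub_le_uncoveredProb hG hx u)
    have := mul_le_mul_of_nonneg_left (hdeg u) hL
    linarith
  have hp : uncoveredProb G x v ≤ 1 + 1 / 2 * (L * G.maxDegree) ^ 2 +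
      -L * ∑ u ∈ G.neighborFinset v, uncoveredProb G x u := by
    rw [uncoveredProb_eq hG hx v, ← average_card_uncoveredNeighbors, ← average_affine G hx]
    refine average_mono G hx fun I => ?_
    rw [← hLdef]
    have hF : ((uncoveredNeighbors G I v).card : ℝ) ≤ G.maxDegree := by
      refine le_trans ?_ (hdeg v)
      rw [← G.card_neighborFinset_eq_degree v]
      refine Nat.cast_le.2 (Finset.card_le_card fun w hw => ?_)
      simpa using (mem_uncoveredNeighbors.1 hw).1
    set y := L * ((uncoveredNeighbors G I v).card : ℝ) with hy
    have hy0 : 0 ≤ y := by positivity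
    have hyle : y ≤ L * G.maxDegree := by rw [hy]; gcongr
    have hsq : y ^ 2 ≤ (L * G.maxDegree) ^ 2 := by gcongr
    -- `exp (-y) ≤ 1 / (1 + y + y ^ 2 / 2) ≤ 1 - y + y ^ 2 / 2` for `0 ≤ y`.
    have hexp : Real.exp (-y) ≤ 1 - y + y ^ 2 / 2 := by
      have h1 := Real.quadratic_le_exp_of_nonneg hy0
      have h2 : Real.exp (-y) * Real.exp y = 1 := by rw [← Real.exp_add]; simp
      nlinarith [Real.exp_pos (-y), mul_le_mul_of_nonneg_left h1 (Real.exp_pos (-y)).le,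
        pow_nonneg hy0 4, mul_nonneg (Real.exp_pos (-y)).le (pow_nonneg hy0 4),
        sq_nonneg (y - 1)]
    calc Real.exp (-y) ≤ 1 - y + y ^ 2 / 2 := hexp
      _ ≤ _ := by rw [neg_mul, ← hy]; linarith
  have h1 := mul_le_mul_of_nonneg_left hs hL
  have h2 : L * G.degree v * (L * G.maxDegree) ≤ (L * G.maxDegree) ^ 2 := by
    rw [sq]
    exact mul_le_mul_of_nonneg_right (mul_le_mul_of_nonneg_left (hdeg v) hL) (by positivity)
  linarith

/-- When `log (1 + x) * Δ ^ 2` is small, the first-order term of the uncovered probabilities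
dominates as soon as two degrees differ, so that a smaller degree means a larger probability. -/
theorem uncoveredProb_le_of_degree_lt {G : SimpleGraph V} [DecidableRel G.Adj]
    (hG : G.CliqueFree 3) {x : ℝ} (hx : 0 < x)
    (hsmall : Real.log (1 + x) * (G.maxDegree : ℝ) ^ 2 ≤ 1 / 2) {u v : V}
    (h : G.degree u < G.degree v) : uncoveredProb G x v ≤ uncoveredProb G x u := by
  have hL : 0 ≤ Real.log (1 + x) := Real.log_nonneg (by linarith)
  have hd : (G.degree u : ℝ) + 1 ≤ G.degree v := by exact_mod_cast h
  have h1 := one_sub_le_uncoveredProb hG hx u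
  have h2 := uncoveredProb_le hG hx v
  have h3 := mul_le_mul_of_nonneg_left hd hL
  have h4 := mul_le_mul_of_nonneg_left hsmall hL
  nlinarith

end HardCore

/-! ### The Lambert function -/

theorem lambertW_monotoneOn : MonotoneOn lambertW (Set.Ici 0) := by
  intro a ha b hb hab
  by_contra! h
  obtain ⟨_, ha2⟩ := lambertW_spec ha
  obtain ⟨hb1, hb2⟩ := lambertW_spec hb
  have : lambertW b * Real.exp (lambertW b) < lambertW a * Real.exp (lambertW a) :=
    mul_lt_mul'' h (Real.exp_lt_exp.2 h) hb1 (Real.exp_pos _).le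
  linarith

theorem lambertWDiv_eq_exp {x : ℝ} (hx : 0 ≤ x) : lambertWDiv x = Real.exp (-lambertW x) := by
  obtain ⟨-, h⟩ := lambertW_spec hx
  unfold lambertWDiv
  split_ifs with h0
  · have := lambertW_mul_exp le_rfl
    rw [zero_mul] at this
    simp [h0, this]
  · have hw : lambertW x ≠ 0 := fun hw => h0 (by rw [← h, hw, zero_mul])
    rw [Real.exp_neg, div_eq_iff h0, ← div_eq_inv_mul, eq_div_iff (Real.exp_pos _).ne', h]

/-! ### Comparison of the vertex sums -/

/-- The sum `∑ v, a v * ∑ u ~ v, (p v - p u)` equals `∑ uv ∈ E, (a v - a u) * (p v - p u)`, so it is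
nonnegative if `a` and `p` are similarly
ordered along the edges. -/
theorem SimpleGraph.sum_neighborFinset_mul_sub_nonneg {V : Type*} [Fintype V] (G : SimpleGraph V)
    [DecidableRel G.Adj] (a p : V → ℝ) (h : ∀ u v, 0 ≤ (a v - a u) * (p v - p u)) :
    0 ≤ ∑ v, ∑ u ∈ G.neighborFinset v, a v * (p v - p u) := by
  classical
  have e (f : V → V → ℝ) : ∑ v, ∑ u ∈ G.neighborFinset v, f v u =
      ∑ v, ∑ u, if G.Adj v u then f v u else 0 := by
    refine Finset.sum_congr rfl fun v _ => ?_
    rw [← Finset.sum_filter, G.neighborFinset_eq_filter]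
  have swap : ∑ v, ∑ u ∈ G.neighborFinset v, a v * (p v - p u) =
      ∑ v, ∑ u ∈ G.neighborFinset v, a u * (p u - p v) := by
    rw [e, e, Finset.sum_comm]
    simp_rw [G.adj_comm]
  have hsum : 0 ≤ ∑ v, ∑ u ∈ G.neighborFinset v, (a v - a u) * (p v - p u) :=
    Finset.sum_nonneg fun v _ => Finset.sum_nonneg fun u _ => h u v
  have : ∑ v, ∑ u ∈ G.neighborFinset v, (a v - a u) * (p v - p u) =
      ∑ v, ∑ u ∈ G.neighborFinset v, a v * (p v - p u) +
        ∑ v, ∑ u ∈ G.neighborFinset v, a u * (p u - p v) := by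
    simp_rw [← Finset.sum_add_distrib]
    exact Finset.sum_congr rfl fun v _ => Finset.sum_congr rfl fun u _ => by ring
  linarith

namespace HardCore

/-- Summing the tangent bounds at `t = W (d log (1 + x))` with weights `1 / (1 + t)` compares the
uncovered probabilities `p` with the numbers `q = exp (-t)`. The error is `log (1 + x)` times the
sum of `(a v - a u) * (p v - p u)` over the edges, where `a = q / (1 + t)`; `a` and `p` both decrease
with the degree. -/
theorem sum_lambertWDiv_le_sum_uncoveredProb {V : Type*} [Fintype V] {G : SimpleGraph V}
    [DecidableRel G.Adj] (hG : G.CliqueFree 3) {x : ℝ} (hx : 0 < x)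
    (hsmall : Real.log (1 + x) * (G.maxDegree : ℝ) ^ 2 ≤ 1 / 2) :
    ∑ v, lambertWDiv (G.degree v * Real.log (1 + x)) ≤ ∑ v, uncoveredProb G x v := by
  set L := Real.log (1 + x) with hLdef
  have hL : 0 ≤ L := Real.log_nonneg (by linarith)
  have harg (v : V) : 0 ≤ (G.degree v : ℝ) * L := by positivity
  set p : V → ℝ := uncoveredProb G x with hp
  set w : V → ℝ := fun v => lambertW (G.degree v * L) with hw
  set a : V → ℝ := fun v => Real.exp (-w v) / (1 + w v) with ha
  have hw0 (v : V) : 0 ≤ w v := (lambertW_spec (harg v)).1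
  have hwexp (v : V) : w v = G.degree v * L * Real.exp (-w v) := by
    rw [← (lambertW_spec (harg v)).2, mul_assoc, ← Real.exp_add]
    simp [hw]
  have ha_anti {u v : V} (h : G.degree u ≤ G.degree v) : a v ≤ a u := by
    have hwle : w u ≤ w v := lambertW_monotoneOn (harg u) (harg v) (by gcongr)
    have := hw0 u
    simp only [ha]
    gcongr
  have hsim (u v : V) : 0 ≤ (a v - a u) * (p v - p u) := by
    rcases lt_trichotomy (G.degree u) (G.degree v) with h | h | h
    · exact mul_nonneg_of_nonpos_of_nonpos (sub_nonpos.2 (ha_anti h.le))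
        (sub_nonpos.2 (uncoveredProb_le_of_degree_lt hG hx hsmall h))
    · rw [le_antisymm (ha_anti h.le) (ha_anti h.ge)]
      simp
    · exact mul_nonneg (sub_nonneg.2 (ha_anti h.le))
        (sub_nonneg.2 (uncoveredProb_le_of_degree_lt hG hx hsmall h))
  have hvertex (v : V) : lambertWDiv (G.degree v * L) +
      L * ∑ u ∈ G.neighborFinset v, a v * (p v - p u) ≤ p v := by
    have ht := uncoveredProb_ge_tangent hG hx v (w v)
    rw [← hLdef, ← hp] at ht
    have h1 : 0 < 1 + w v := by linarith [hw0 v]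
    rw [lambertWDiv_eq_exp (harg v), ← Finset.mul_sum, Finset.sum_sub_distrib, Finset.sum_const,
      G.card_neighborFinset_eq_degree, nsmul_eq_mul]
    change Real.exp (-w v) + _ ≤ _
    have hda : G.degree v * L * a v * (1 + w v) = w v := by
      rw [mul_assoc, ha, div_mul_cancel₀ _ h1.ne', ← hwexp v]
    have haw : a v * (1 + w v) = Real.exp (-w v) := div_mul_cancel₀ _ h1.ne'
    refine le_of_mul_le_mul_right ?_ h1
    calc _ = Real.exp (-w v) * (1 + w v) + p v * (G.degree v * L * a v * (1 + w v)) -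
          L * (∑ u ∈ G.neighborFinset v, p u) * (a v * (1 + w v)) := by ring
      _ ≤ _ := by
        rw [hda, haw]
        linarith
  have hform := mul_nonneg hL (G.sum_neighborFinset_mul_sub_nonneg a p hsim)
  have hsum := Finset.sum_le_sum fun v (_ : v ∈ Finset.univ) => hvertex v
  rw [Finset.sum_add_distrib, ← Finset.mul_sum] at hsum
  linarith

end HardCore

theorem theorem4 :
    ∃ c : ℝ, 0 < c ∧
      ∀ (V : Type*) [Fintype V] [Nonempty V] (G : SimpleGraph V) [DecidableRel G.Adj],
        G.CliqueFree 3 →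
        ∀ lam : ℝ, 0 < lam → lam * (G.maxDegree : ℝ) ^ 4 ≤ c →
          1 / (Fintype.card V : ℝ) *
              ∑ u : V, lam / (1 + lam) * lambertWDiv ((G.degree u : ℝ) * Real.log (1 + lam)) ≤
            HardCore.occupancyFraction G lam := by
  refine ⟨1 / 2, by norm_num, fun V _ _ G _ hG lam hlam hsmall => ?_⟩
  have hL : Real.log (1 + lam) ≤ lam := by
    linarith [Real.log_le_sub_one_of_pos (show 0 < 1 + lam by linarith)]
  have hpow : (G.maxDegree : ℝ) ^ 2 ≤ (G.maxDegree : ℝ) ^ 4 := by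
    norm_cast
    rcases Nat.eq_zero_or_pos G.maxDegree with h | h
    · simp [h]
    · exact Nat.pow_le_pow_right h (by norm_num)
  have hsmall' : Real.log (1 + lam) * (G.maxDegree : ℝ) ^ 2 ≤ 1 / 2 :=
    (mul_le_mul hL hpow (by positivity) hlam.le).trans hsmall
  rw [HardCore.occupancyFraction_eq G hlam, ← Finset.mul_sum, ← Finset.mul_sum]
  have := HardCore.sum_lambertWDiv_le_sum_uncoveredProb hG hlam hsmall'
  gcongr
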